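/- Let $T_n$ ($n\in\mathbb Z$) be the Chebyshev polynomials, $T_0=1$, $T_1=t$, $T_{n+1}=2tT_n-T_{n-1}$. Let $a,b$ be coprime positive integers and $c=ab-a-b$. Then the curve $$t\mapsto (x(t),y(t),z(t))=(T_a(t),T_b(t),T_c(t)),\qquad t\in\mathbb R,$$ is a smooth proper embedding of $\mathbb R$ in $\mathbb R^3$ (the harmonic knot $H(a,b,c)$), and its projection to the $(x,y)$-plane is an alternating knot diagram. That is, the projection is a proper immersion whose only singularities are finitely many transverse double points, the two strands having different heights $z$ at each of them, and over- and underpassages alternate along the curve: of any two consecutive parameters of crossing points, one belongs to an overpassage and the other to an underpassage, and the same holds for the first and the last such parameter (if there are any), since the knot is closed up through the point at infinity. Moreover, for every integer $u$ with $0\le u\le ab$, $a\nmid u$, $b\nmid u$, the parameter $t_u=\cos\left(\frac{u\pi}{ab}\right)$ is a parameter of a crossing point, and if $s\neq t_u$ is the other parameter of this crossing point, then $D=(z(t_u)-z(s))\,x'(t_u)\,y'(t_u)$ satisfies $\operatorname{sign} D=-(-1)^u$. -/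

import Mathlib

open Filter Polynomial
open scoped ContDiff

/-- The harmonic curve `t ↦ (T_a(t), T_b(t), T_c(t))`, where `T_n` (for `n` an integer) is the
`n`-th Chebyshev polynomial of the first kind; it is the curve underlying `H(a, b, c)`. -/
noncomputable def harmonicCurve (a b c : ℤ) (t : ℝ) : EuclideanSpace ℝ (Fin 3) :=
  !₂[(Chebyshev.T ℝ a).eval t, (Chebyshev.T ℝ b).eval t, (Chebyshev.T ℝ c).eval t]

/-- The projection of space onto the `(x, y)`-plane, applied to a parametrized curve. -/
noncomputable def planeProjection (γ : ℝ → EuclideanSpace ℝ (Fin 3)) (t : ℝ) :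
    EuclideanSpace ℝ (Fin 2) :=
  !₂[γ t 0, γ t 1]

/-- A parametrized long knot: a smooth proper embedding of the line into space. -/
structure IsLongKnot (γ : ℝ → EuclideanSpace ℝ (Fin 3)) : Prop where
  smooth : ContDiff ℝ ∞ γ
  injective : Function.Injective γ
  deriv_ne_zero : ∀ t, deriv γ t ≠ 0
  proper : Tendsto γ (cocompact ℝ) (cocompact (EuclideanSpace ℝ (Fin 3)))

/-- The distinct parameters `t` and `s` give the same point of the `(x, y)`-projection. -/
def IsCrossingPair (γ : ℝ → EuclideanSpace ℝ (Fin 3)) (t s : ℝ) : Prop :=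
  t ≠ s ∧ planeProjection γ t = planeProjection γ s

/-- The parameters at which the `(x, y)`-projection passes through a crossing point. -/
def crossingParams (γ : ℝ → EuclideanSpace ℝ (Fin 3)) : Set ℝ :=
  {t | ∃ s, IsCrossingPair γ t s}

/-- The strand of parameter `t` passes over the other strand at its crossing point. -/
def IsOver (γ : ℝ → EuclideanSpace ℝ (Fin 3)) (t : ℝ) : Prop :=
  ∃ s, IsCrossingPair γ t s ∧ γ s 2 < γ t 2

/-- The strand of parameter `t` passes under the other strand at its crossing point. -/
def IsUnder (γ : ℝ → EuclideanSpace ℝ (Fin 3)) (t : ℝ) : Prop :=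
  ∃ s, IsCrossingPair γ t s ∧ γ t 2 < γ s 2

/-- The `(x, y)`-projection of `γ`, with heights given by `z`, is a regular knot diagram: the
projection is a proper immersion whose only singularities are finitely many transverse double
points, and the two strands have different heights at each of them. -/
structure IsRegularDiagram (γ : ℝ → EuclideanSpace ℝ (Fin 3)) : Prop where
  smooth : ContDiff ℝ ∞ (planeProjection γ)
  deriv_ne_zero : ∀ t, deriv (planeProjection γ) t ≠ 0
  proper : Tendsto (planeProjection γ) (cocompact ℝ) (cocompact (EuclideanSpace ℝ (Fin 2)))
  finite : (crossingParams γ).Finite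
  no_triple : ∀ t s r, IsCrossingPair γ t s → IsCrossingPair γ t r → s = r
  transverse : ∀ t s, IsCrossingPair γ t s →
    LinearIndependent ℝ ![deriv (planeProjection γ) t, deriv (planeProjection γ) s]
  height_ne : ∀ t s, IsCrossingPair γ t s → γ t 2 ≠ γ s 2

/-- At one of the parameters `t`, `t'` the strand passes over and at the other one it passes
under. -/
def OppositePassages (γ : ℝ → EuclideanSpace ℝ (Fin 3)) (t t' : ℝ) : Prop :=
  (IsOver γ t ∧ IsUnder γ t') ∨ (IsUnder γ t ∧ IsOver γ t')

/-- The `(x, y)`-projection of `γ` is an alternating diagram: it is regular, and over- and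
underpassages alternate along the knot, which is closed up through the point at infinity, so that
the last passage is followed by the first one. -/
structure IsAlternatingDiagram (γ : ℝ → EuclideanSpace ℝ (Fin 3)) : Prop where
  regular : IsRegularDiagram γ
  consecutive : ∀ t t', t ∈ crossingParams γ → t' ∈ crossingParams γ → t < t' →
    (∀ r, t < r → r < t' → r ∉ crossingParams γ) → OppositePassages γ t t'
  closing : ∀ t t', IsLeast (crossingParams γ) t → IsGreatest (crossingParams γ) t' →
    OppositePassages γ t t'

/-- The expression `D = (z(t) - z(s)) x'(t) y'(t)`, whose sign describes the nature of the crossing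
point with parameters `t` and `s`. -/
noncomputable def crossingD (γ : ℝ → EuclideanSpace ℝ (Fin 3)) (t s : ℝ) : ℝ :=
  (γ t 2 - γ s 2) * deriv (fun r => γ r 0) t * deriv (fun r => γ r 1) t

/-! ### Trigonometric and arithmetic preliminaries -/

/-! Double points of the projection have both parameters in `[-1, 1]`, so write `t = cos τ`, `s =
cos σ`. Then `cos aτ = cos aσ` and `cos bτ = cos bσ`; up to the sign of `σ`, the only case with `t ≠
s` is `a(τ - σ) = 2kπ`, `b(τ + σ) = 2lπ`. Hence `τ = uπ/(ab)` with `u = kb + la` divisible by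
neither `a` nor `b` (`exists_int_of_isCrossingPair_harmonicCurve`).

The choice `c = ab - a - b` makes the height difference `-2(-1)^u sin(uπ/a) sin(uπ/b)`
(`eval_T_sub_eval_T_of_eq`). It is nonzero, and its sign is `(-1)^(u + ⌊u/a⌋ + ⌊u/b⌋ + 1)`. Between
consecutive admissible `u < v`, each skipped integer raises exactly one quotient by one, so the
exponent grows by `(v - u) + (v - u - 1)`, which is odd: passages alternate. At infinity they
alternate because `c` is odd and `t ↦ -t` preserves crossings. Finally `x'y'` has the sign of
`sin(uπ/a) sin(uπ/b)`, so in `D` only `-(-1)^u` survives. -/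

theorem sin_int_mul_pi_div_ne_zero {n : ℕ} (hn : 0 < n) {u : ℤ} (hu : ¬ (n : ℤ) ∣ u) :
    Real.sin (u * Real.pi / n) ≠ 0 := by
  intro h
  obtain ⟨m, hm⟩ := Real.sin_eq_zero_iff.1 h
  have hn' : (n : ℝ) ≠ 0 := by positivity
  have : ((m * n : ℤ) : ℝ) = (u : ℤ) := by
    field_simp at hm
    push_cast
    linarith
  exact hu ⟨m, by rw [mul_comm]; exact_mod_cast this.symm⟩

/-- Removing `u / n` half-turns, each a sign change, leaves the angle `(u % n)π/n` in `(0, π)`. -/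
theorem neg_one_pow_div_mul_sin_pos {n : ℕ} (hn : 0 < n) {u : ℕ} (hu : ¬ n ∣ u) :
    0 < (-1) ^ (u / n) * Real.sin (u * Real.pi / n) := by
  have hn' : (0 : ℝ) < n := by positivity
  have hr : 0 < u % n := Nat.pos_of_ne_zero fun h => hu (Nat.dvd_of_mod_eq_zero h)
  have hr' : u % n < n := Nat.mod_lt _ hn
  have hdecomp : (u : ℝ) = n * (u / n : ℕ) + (u % n : ℕ) := by
    exact_mod_cast (Nat.div_add_mod u n).symm
  have hangle : (u : ℝ) * Real.pi / n = (u % n : ℕ) * Real.pi / n + (u / n : ℕ) * Real.pi := by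
    conv_lhs => rw [hdecomp]
    field_simp
    ring
  rw [hangle, Real.sin_add_nat_mul_pi, ← mul_assoc, ← mul_pow]
  norm_num only [one_pow, one_mul]
  have hrR : (0 : ℝ) < (u % n : ℕ) := by exact_mod_cast hr
  have hrR' : ((u % n : ℕ) : ℝ) < n := by exact_mod_cast hr'
  apply Real.sin_pos_of_pos_of_lt_pi
  · have := Real.pi_pos
    positivity
  · rw [div_lt_iff₀ hn', mul_comm]
    exact mul_lt_mul_of_pos_left hrR' Real.pi_pos

/-- A positive integer below `ab` cannot be a multiple of both, so each step raises exactly one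
quotient. -/
theorem div_add_div_eq_of_forall_dvd {a b : ℕ} (hab : Nat.Coprime a b) {u : ℕ} :
    ∀ n, u + n < a * b → (∀ r, u < r → r ≤ u + n → a ∣ r ∨ b ∣ r) →
      (u + n) / a + (u + n) / b = u / a + u / b + n := by
  intro n
  induction n with
  | zero => simp
  | succ n ih =>
    intro hlt hdvd
    have ih' := ih (by omega) fun r h₁ h₂ => hdvd r h₁ (by omega)
    have hnot : ¬ (a ∣ u + n + 1 ∧ b ∣ u + n + 1) := fun h =>
      absurd (Nat.le_of_dvd (by omega) (hab.mul_dvd_of_dvd_of_dvd h.1 h.2)) (by omega)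
    rw [← add_assoc, Nat.succ_div, Nat.succ_div]
    rcases hdvd (u + n + 1) (by omega) (by omega) with h | h
    · have h' : ¬ b ∣ u + n + 1 := fun h' => hnot ⟨h, h'⟩
      simp only [h, h', if_true, if_false]
      omega
    · have h' : ¬ a ∣ u + n + 1 := fun h' => hnot ⟨h', h⟩
      simp only [h, h', if_true, if_false]
      omega

/-- The quotients count the skipped multiples between two consecutive non-multiples `u < v`. -/
theorem div_add_div_of_consecutive {a b : ℕ} (hab : Nat.Coprime a b) {u v : ℕ} (huv : u < v)
    (hv : v < a * b) (hav : ¬ a ∣ v) (hbv : ¬ b ∣ v)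
    (hdvd : ∀ r, u < r → r < v → a ∣ r ∨ b ∣ r) :
    v + (u / a + u / b) = u + (v / a + v / b) + 1 := by
  obtain ⟨n, rfl⟩ : ∃ n, v = u + n + 1 := ⟨v - u - 1, by omega⟩
  have h := div_add_div_eq_of_forall_dvd hab n (by omega) fun r h₁ h₂ => hdvd r h₁ (by omega)
  rw [Nat.succ_div_of_not_dvd hav, Nat.succ_div_of_not_dvd hbv, h]
  omega

/-! ### Chebyshev polynomials -/

theorem Polynomial.Chebyshev.eval_derivative_T_cos_mul_sin (n : ℤ) (θ : ℝ) :
    (derivative (Chebyshev.T ℝ n)).eval (Real.cos θ) * Real.sin θ = n * Real.sin (n * θ) := by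
  rw [Chebyshev.T_derivative_eq_U, eval_mul, mul_assoc, Chebyshev.U_real_cos]
  simp

/-- The critical points are the roots of `U_{n-1}`, all real and inside `(-1, 1)`. -/
theorem Polynomial.Chebyshev.exists_cos_eq_of_eval_derivative_T_eq_zero {n : ℕ} (hn : 0 < n) {t : ℝ}
    (ht : (derivative (Chebyshev.T ℝ n)).eval t = 0) :
    ∃ θ, t = Real.cos θ ∧ Real.sin θ ≠ 0 := by
  obtain ⟨m, rfl⟩ : ∃ m, n = m + 1 := ⟨n - 1, by omega⟩
  rw [Chebyshev.T_derivative_eq_U, eval_mul] at ht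
  have hU : (Chebyshev.U ℝ (m : ℤ)).eval t = 0 := by
    rcases mul_eq_zero.1 ht with h | h
    · exfalso
      simp at h
      norm_cast at h
    · simpa using h
  have hmem : t ∈ (Chebyshev.U ℝ (m : ℤ)).roots := by
    rw [mem_roots (Chebyshev.U_ne_zero ℝ _ (by omega))]
    exact hU
  rw [Chebyshev.roots_U_real] at hmem
  obtain ⟨k, hk, rfl⟩ := Finset.mem_image.1 (Finset.mem_def.2 hmem)
  refine ⟨_, rfl, (Real.sin_pos_of_pos_of_lt_pi ?_ ?_).ne'⟩
  · have := Real.pi_pos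
    positivity
  · have hk' : (k : ℝ) < m := by exact_mod_cast Finset.mem_range.1 hk
    rw [div_lt_iff₀ (by positivity), mul_comm]
    exact mul_lt_mul_of_pos_left (by linarith) Real.pi_pos

theorem exists_eq_int_mul_pi_of_coprime {a b : ℕ} (hab : Nat.Coprime a b) {x : ℝ} {m n : ℤ}
    (hm : a * x = m * Real.pi) (hn : b * x = n * Real.pi) : ∃ k : ℤ, x = k * Real.pi := by
  obtain ⟨p, q, hpq⟩ := Nat.isCoprime_iff_coprime.2 hab
  have hpq' : (p : ℝ) * a + q * b = 1 := by exact_mod_cast hpq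
  refine ⟨p * m + q * n, ?_⟩
  push_cast
  linear_combination (-x) * hpq' + p * hm + q * hn

theorem Polynomial.Chebyshev.eval_derivative_T_ne_zero_of_coprime {a b : ℕ} (ha : 0 < a)
    (hb : 0 < b) (hab : Nat.Coprime a b) {t : ℝ}
    (h₁ : (derivative (Chebyshev.T ℝ a)).eval t = 0) :
    (derivative (Chebyshev.T ℝ b)).eval t ≠ 0 := by
  intro h₂
  obtain ⟨θ, rfl, hθ⟩ := exists_cos_eq_of_eval_derivative_T_eq_zero ha h₁
  have e₁ := eval_derivative_T_cos_mul_sin a θ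
  have e₂ := eval_derivative_T_cos_mul_sin b θ
  rw [h₁, zero_mul] at e₁
  rw [h₂, zero_mul] at e₂
  push_cast at e₁ e₂
  have s₁ : Real.sin (a * θ) = 0 :=
    (mul_eq_zero.1 e₁.symm).resolve_left (by positivity)
  have s₂ : Real.sin (b * θ) = 0 :=
    (mul_eq_zero.1 e₂.symm).resolve_left (by positivity)
  obtain ⟨m, hm⟩ := Real.sin_eq_zero_iff.1 s₁
  obtain ⟨n, hn⟩ := Real.sin_eq_zero_iff.1 s₂
  obtain ⟨k, rfl⟩ := exists_eq_int_mul_pi_of_coprime hab hm.symm hn.symm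
  exact hθ (Real.sin_int_mul_pi k)

theorem Polynomial.Chebyshev.tendsto_norm_eval_T {n : ℕ} (hn : 0 < n) :
    Tendsto (fun t : ℝ => ‖(Chebyshev.T ℝ n).eval t‖) (cocompact ℝ) atTop := by
  refine Polynomial.tendsto_norm_atTop _ ?_ tendsto_norm_cocompact_atTop
  rw [Chebyshev.degree_T]
  simpa using hn

/-- Outside `[-1, 1]`, `|T_n(x)| = cosh(n arcosh |x|)` exceeds 1 and is injective in `|x|`. -/
theorem Polynomial.Chebyshev.abs_eq_abs_of_eval_T_eq {n : ℕ} (hn : 0 < n) {t s : ℝ} (ht : 1 < |t|)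
    (h : (Chebyshev.T ℝ n).eval t = (Chebyshev.T ℝ n).eval s) : |t| = |s| := by
  have hn0 : (n : ℤ) ≠ 0 := by omega
  have key : ∀ x : ℝ, 1 < |x| →
      |(Chebyshev.T ℝ n).eval x| = Real.cosh (n * Real.arcosh |x|) := by
    intro x hx
    have h1 : |(Chebyshev.T ℝ n).eval x| = |(Chebyshev.T ℝ n).eval (abs x)| := by
      rcases abs_choice x with h | h <;> rw [h]
      simp [Chebyshev.T_eval_neg, abs_mul]
    rw [h1]
    conv_lhs => rw [← Real.cosh_arcosh hx.le]
    rw [Chebyshev.T_real_cosh, abs_of_pos (Real.cosh_pos _)]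
    simp
  have hs : 1 < |s| := by
    by_contra hs
    have h1 := Chebyshev.abs_eval_T_real_le_one n (not_lt.1 hs)
    rw [← h] at h1
    exact absurd (Chebyshev.one_lt_abs_eval_T_real hn0 ht) (not_lt.2 h1)
  have hcosh : Real.cosh (n * Real.arcosh |t|) = Real.cosh (n * Real.arcosh |s|) := by
    rw [← key t ht, ← key s hs, h]
  have h0 : (0 : ℝ) < n := by exact_mod_cast hn
  have e1 := Real.cosh_injOn
    (show _ ∈ Set.Ici (0:ℝ) from mul_nonneg h0.le (Real.arcosh_nonneg ht.le))
    (show _ ∈ Set.Ici (0:ℝ) from mul_nonneg h0.le (Real.arcosh_nonneg hs.le)) hcosh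
  rw [← Real.cosh_arcosh ht.le, ← Real.cosh_arcosh hs.le, mul_left_cancel₀ h0.ne' e1]

/-- Otherwise `s = -t`, and parity of `T_a`, `T_b` would make both `a` and `b` even. -/
theorem Polynomial.Chebyshev.abs_le_one_of_eval_T_eq {a b : ℕ} (ha : 0 < a) (hb : 0 < b)
    (hab : Nat.Coprime a b) {t s : ℝ} (hts : t ≠ s)
    (h₁ : (Chebyshev.T ℝ a).eval t = (Chebyshev.T ℝ a).eval s)
    (h₂ : (Chebyshev.T ℝ b).eval t = (Chebyshev.T ℝ b).eval s) : |t| ≤ 1 := by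
  by_contra! ht
  have hs : s = -t := by
    rcases abs_eq_abs.1 (abs_eq_abs_of_eval_T_eq ha ht h₁) with h | h
    · exact absurd h hts
    · rw [h, neg_neg]
  have heven : ∀ n : ℕ, 0 < n → (Chebyshev.T ℝ n).eval t = (Chebyshev.T ℝ n).eval s →
      2 ∣ n := by
    intro n hn h
    by_contra hodd
    have hodd' : Odd n := Nat.not_even_iff_odd.1 fun h => hodd h.two_dvd
    have h0 := Chebyshev.one_lt_abs_eval_T_real (n := n) (by omega) ht
    rw [hs, Chebyshev.T_eval_neg, Int.negOnePow_odd _ (by exact_mod_cast hodd')] at h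
    have : (Chebyshev.T ℝ n).eval t = 0 := by
      push_cast at h
      linarith
    rw [this] at h0
    norm_num at h0
  exact absurd (Nat.dvd_gcd (heven a ha h₁) (heven b hb h₂)) (by rw [hab]; norm_num)

/-! ### Curves in Euclidean space -/

theorem deriv_euclidean_apply {n : ℕ} {f : ℝ → EuclideanSpace ℝ (Fin n)} (hf : ContDiff ℝ ∞ f)
    (t : ℝ) (i : Fin n) : deriv f t i = deriv (fun r => f r i) t := by
  have hd : HasDerivAt f (deriv f t) t :=
    (hf.differentiable (by simp)).differentiableAt.hasDerivAt
  exact ((EuclideanSpace.proj (𝕜 := ℝ) i).hasFDerivAt.comp_hasDerivAt t hd).deriv.symm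

theorem tendsto_cocompact_of_tendsto_norm_apply {n : ℕ} {f : ℝ → EuclideanSpace ℝ (Fin n)}
    (i : Fin n) (h : Tendsto (fun t => ‖f t i‖) (cocompact ℝ) atTop) :
    Tendsto f (cocompact ℝ) (cocompact (EuclideanSpace ℝ (Fin n))) := by
  rw [← Metric.cobounded_eq_cocompact (α := EuclideanSpace ℝ (Fin n)),
    ← tendsto_norm_atTop_iff_cobounded]
  exact tendsto_atTop_mono (fun t => PiLp.norm_apply_le (f t) i) h

theorem Polynomial.contDiff_eval (p : ℝ[X]) {n : WithTop ℕ∞} :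
    ContDiff ℝ n fun t : ℝ => p.eval t := by
  simpa [Polynomial.aeval_def, Polynomial.eval₂_eq_eval_map] using p.contDiff_aeval (𝕜 := ℝ) n

/-! ### Crossings of the harmonic curve and their heights -/

section HarmonicCurve

variable {a b : ℕ} {c : ℤ}

@[simp] theorem harmonicCurve_zero (a b c : ℤ) (t : ℝ) :
    harmonicCurve a b c t 0 = (Chebyshev.T ℝ a).eval t := rfl

@[simp] theorem harmonicCurve_one (a b c : ℤ) (t : ℝ) :
    harmonicCurve a b c t 1 = (Chebyshev.T ℝ b).eval t := rfl

@[simp] theorem harmonicCurve_two (a b c : ℤ) (t : ℝ) :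
    harmonicCurve a b c t 2 = (Chebyshev.T ℝ c).eval t := rfl

theorem contDiff_harmonicCurve (a b c : ℤ) : ContDiff ℝ ∞ (harmonicCurve a b c) := by
  rw [contDiff_euclidean]
  intro i
  fin_cases i
  · exact Polynomial.contDiff_eval (Chebyshev.T ℝ a)
  · exact Polynomial.contDiff_eval (Chebyshev.T ℝ b)
  · exact Polynomial.contDiff_eval (Chebyshev.T ℝ c)

theorem contDiff_planeProjection_harmonicCurve (a b c : ℤ) :
    ContDiff ℝ ∞ (planeProjection (harmonicCurve a b c)) := by
  rw [contDiff_euclidean]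
  intro i
  fin_cases i
  · exact Polynomial.contDiff_eval (Chebyshev.T ℝ a)
  · exact Polynomial.contDiff_eval (Chebyshev.T ℝ b)

theorem deriv_planeProjection_harmonicCurve_zero (a b c : ℤ) (t : ℝ) :
    deriv (planeProjection (harmonicCurve a b c)) t 0 =
      (derivative (Chebyshev.T ℝ a)).eval t := by
  rw [deriv_euclidean_apply (contDiff_planeProjection_harmonicCurve a b c)]
  exact (Chebyshev.T ℝ a).deriv

theorem deriv_planeProjection_harmonicCurve_one (a b c : ℤ) (t : ℝ) :
    deriv (planeProjection (harmonicCurve a b c)) t 1 =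
      (derivative (Chebyshev.T ℝ b)).eval t := by
  rw [deriv_euclidean_apply (contDiff_planeProjection_harmonicCurve a b c)]
  exact (Chebyshev.T ℝ b).deriv

theorem deriv_harmonicCurve_zero (a b c : ℤ) (t : ℝ) :
    deriv (harmonicCurve a b c) t 0 = (derivative (Chebyshev.T ℝ a)).eval t := by
  rw [deriv_euclidean_apply (contDiff_harmonicCurve a b c)]
  exact (Chebyshev.T ℝ a).deriv

theorem deriv_harmonicCurve_one (a b c : ℤ) (t : ℝ) :
    deriv (harmonicCurve a b c) t 1 = (derivative (Chebyshev.T ℝ b)).eval t := by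
  rw [deriv_euclidean_apply (contDiff_harmonicCurve a b c)]
  exact (Chebyshev.T ℝ b).deriv

theorem isCrossingPair_harmonicCurve_iff (a b c : ℤ) (t s : ℝ) :
    IsCrossingPair (harmonicCurve a b c) t s ↔ t ≠ s ∧
      (Chebyshev.T ℝ a).eval t = (Chebyshev.T ℝ a).eval s ∧
      (Chebyshev.T ℝ b).eval t = (Chebyshev.T ℝ b).eval s := by
  refine and_congr_right fun _ => ⟨fun h => ⟨?_, ?_⟩, fun h => ?_⟩
  · simpa [planeProjection] using congrArg (fun v => v 0) h
  · simpa [planeProjection] using congrArg (fun v => v 1) h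
  · simp only [planeProjection, harmonicCurve_zero, harmonicCurve_one, h.1, h.2]

theorem IsCrossingPair.symm {γ : ℝ → EuclideanSpace ℝ (Fin 3)} {t s : ℝ}
    (h : IsCrossingPair γ t s) : IsCrossingPair γ s t :=
  ⟨h.1.symm, h.2.symm⟩

theorem IsCrossingPair.neg_harmonicCurve {a b c : ℤ} {t s : ℝ}
    (h : IsCrossingPair (harmonicCurve a b c) t s) :
    IsCrossingPair (harmonicCurve a b c) (-t) (-s) := by
  rw [isCrossingPair_harmonicCurve_iff] at h ⊢
  refine ⟨fun h' => h.1 (neg_injective h'), ?_, ?_⟩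
  · rw [Chebyshev.T_eval_neg, Chebyshev.T_eval_neg, h.2.1]
  · rw [Chebyshev.T_eval_neg, Chebyshev.T_eval_neg, h.2.2]

theorem isCrossingPair_harmonicCurve_cos (ha : 0 < a) (hb : 0 < b) {u k l : ℤ}
    (hu : u = k * b + l * a) (hau : ¬ (a : ℤ) ∣ u) (hbu : ¬ (b : ℤ) ∣ u) :
    IsCrossingPair (harmonicCurve a b c) (Real.cos (u * Real.pi / (a * b)))
      (Real.cos ((l * a - k * b) * Real.pi / (a * b))) := by
  have ha' : (a : ℝ) ≠ 0 := by positivity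
  have hb' : (b : ℝ) ≠ 0 := by positivity
  have hk : ¬ (a : ℤ) ∣ k := fun h => hau (hu ▸ (h.mul_right _).add (dvd_mul_left _ _))
  have hl : ¬ (b : ℤ) ∣ l := fun h => hbu (hu ▸ (dvd_mul_left _ _).add (h.mul_right _))
  have e₁ : (u : ℝ) * Real.pi / (a * b) = l * Real.pi / b + k * Real.pi / a := by
    rw [hu]; push_cast; field_simp; ring
  have e₂ : ((l : ℝ) * a - k * b) * Real.pi / (a * b) = l * Real.pi / b - k * Real.pi / a := by
    field_simp
  rw [isCrossingPair_harmonicCurve_iff, e₁, e₂]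
  refine ⟨fun h => ?_, ?_, ?_⟩
  · rw [Real.cos_add, Real.cos_sub] at h
    have h' : Real.sin (l * Real.pi / b) * Real.sin (k * Real.pi / a) = 0 := by linarith
    exact (mul_ne_zero (sin_int_mul_pi_div_ne_zero hb hl) (sin_int_mul_pi_div_ne_zero ha hk)) h'
  · rw [Chebyshev.T_real_cos, Chebyshev.T_real_cos, Real.cos_eq_cos_iff]
    exact ⟨-k, Or.inl (by push_cast; field_simp; ring)⟩
  · rw [Chebyshev.T_real_cos, Chebyshev.T_real_cos, Real.cos_eq_cos_iff]
    exact ⟨l, Or.inr (by push_cast; field_simp; ring)⟩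

theorem exists_int_of_isCrossingPair_harmonicCurve (ha : 0 < a) (hb : 0 < b)
    (hab : Nat.Coprime a b) {t s : ℝ} (h : IsCrossingPair (harmonicCurve a b c) t s) :
    ∃ u k l : ℤ, u = k * b + l * a ∧ Real.arccos t = u * Real.pi / (a * b) ∧
      t = Real.cos (u * Real.pi / (a * b)) ∧
      s = Real.cos ((l * a - k * b) * Real.pi / (a * b)) ∧
      ¬ (a : ℤ) ∣ u ∧ ¬ (b : ℤ) ∣ u := by
  have ha' : (a : ℝ) ≠ 0 := by positivity
  have hb' : (b : ℝ) ≠ 0 := by positivity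
  have hcop := Nat.isCoprime_iff_coprime.2 hab
  rw [isCrossingPair_harmonicCurve_iff] at h
  obtain ⟨hne, h₁, h₂⟩ := h
  have ht := abs_le.1 (Chebyshev.abs_le_one_of_eval_T_eq ha hb hab hne h₁ h₂)
  have hs := abs_le.1 (Chebyshev.abs_le_one_of_eval_T_eq ha hb hab hne.symm h₁.symm h₂.symm)
  have hct := Real.cos_arccos ht.1 ht.2
  have hcs := Real.cos_arccos hs.1 hs.2
  set τ := Real.arccos t
  set σ₀ := Real.arccos s
  rw [← hct, ← hcs, Chebyshev.T_real_cos, Chebyshev.T_real_cos] at h₁ h₂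
  push_cast at h₁ h₂
  -- It suffices to treat the case where `σ` solves both equations with opposite signs.
  have main : ∀ (σ : ℝ) (k l : ℤ), Real.cos σ = s → a * τ - a * σ = 2 * k * Real.pi →
      b * τ + b * σ = 2 * l * Real.pi →
      ∃ u k l : ℤ, u = k * b + l * a ∧ τ = u * Real.pi / (a * b) ∧
      t = Real.cos (u * Real.pi / (a * b)) ∧
      s = Real.cos ((l * a - k * b) * Real.pi / (a * b)) ∧
      ¬ (a : ℤ) ∣ u ∧ ¬ (b : ℤ) ∣ u := by
    intro σ k l hσ hk hl
    have eτ : τ = ((k * b + l * a : ℤ) : ℝ) * Real.pi / (a * b) := by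
      push_cast
      field_simp
      linear_combination (b / 2 : ℝ) * hk + (a / 2 : ℝ) * hl
    have eσ : σ = ((l : ℝ) * a - k * b) * Real.pi / (a * b) := by
      field_simp
      linear_combination (-b / 2 : ℝ) * hk + (a / 2 : ℝ) * hl
    refine ⟨k * b + l * a, k, l, rfl, eτ, by rw [← eτ, hct], by rw [← eσ, hσ], fun h => hne ?_,
      fun h => hne ?_⟩
    · obtain ⟨m, rfl⟩ : (a : ℤ) ∣ k :=
        hcop.dvd_of_dvd_mul_right ((dvd_add_left (dvd_mul_left _ _)).1 h)
      rw [← hct, ← hσ, Real.cos_eq_cos_iff]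
      refine ⟨-m, Or.inl ?_⟩
      push_cast at hk ⊢
      exact mul_left_cancel₀ ha' (by linear_combination -hk)
    · obtain ⟨m, rfl⟩ : (b : ℤ) ∣ l :=
        hcop.symm.dvd_of_dvd_mul_right ((dvd_add_right (dvd_mul_left _ _)).1 h)
      rw [← hct, ← hσ, Real.cos_eq_cos_iff]
      refine ⟨m, Or.inr ?_⟩
      push_cast at hl ⊢
      exact mul_left_cancel₀ hb' (by linear_combination hl)
  -- With equal signs, Bézout gives `σ ≡ τ` modulo `2π`, contradicting `t ≠ s`.
  have same : ∀ σ : ℝ, Real.cos σ = s → ∀ m n : ℤ, a * σ = 2 * m * Real.pi + a * τ →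
      b * σ = 2 * n * Real.pi + b * τ → False := by
    intro σ hσ m n hm hn
    obtain ⟨k, hk⟩ := exists_eq_int_mul_pi_of_coprime (x := (σ - τ) / 2) hab (m := m) (n := n)
      (by linear_combination (1 / 2 : ℝ) * hm) (by linear_combination (1 / 2 : ℝ) * hn)
    apply hne
    rw [← hct, ← hσ, Real.cos_eq_cos_iff]
    exact ⟨k, Or.inl (by linear_combination 2 * hk)⟩
  obtain ⟨m, hm | hm⟩ := Real.cos_eq_cos_iff.1 h₁ <;>
    obtain ⟨n, hn | hn⟩ := Real.cos_eq_cos_iff.1 h₂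
  · exact (same σ₀ hcs m n hm hn).elim
  · exact main σ₀ (-m) n hcs (by push_cast; linear_combination -hm) (by linear_combination hn)
  -- Replacing `σ₀` by `-σ₀` swaps the two signs without changing `s`.
  · refine main (-σ₀) m (-n) (by rw [Real.cos_neg, hcs]) (by linear_combination hm)
      (by push_cast; linear_combination -hn)
  · refine (same (-σ₀) (by rw [Real.cos_neg, hcs]) (-m) (-n) ?_ ?_).elim
    · push_cast; linear_combination -hm
    · push_cast; linear_combination -hn

/-- With `α = kπ/a`, `β = lπ/b` the angles are `β ± α`, so the difference is `-2 sin cβ sin cα`.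
Modulo `π`, `cα ≡ -bα ≡ -uπ/a` and `cβ ≡ -aβ ≡ -uπ/b`; the discarded multiples of `π` produce
`(-1)^u`. -/
theorem eval_T_sub_eval_T_of_eq (ha : 0 < a) (hb : 0 < b) (hc : c = (a : ℤ) * b - a - b)
    {u k l : ℤ} (hu : u = k * b + l * a) :
    (Chebyshev.T ℝ c).eval (Real.cos (u * Real.pi / (a * b))) -
      (Chebyshev.T ℝ c).eval (Real.cos ((l * a - k * b) * Real.pi / (a * b))) =
      -2 * (-1) ^ u * Real.sin (u * Real.pi / a) * Real.sin (u * Real.pi / b) := by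
  have ha' : (a : ℝ) ≠ 0 := by positivity
  have hb' : (b : ℝ) ≠ 0 := by positivity
  set α : ℝ := k * Real.pi / a with hα
  set β : ℝ := l * Real.pi / b with hβ
  have hcR : (c : ℝ) = a * b - a - b := by rw [hc]; push_cast; ring
  have e₁ : (c : ℝ) * (u * Real.pi / (a * b)) = c * β + c * α := by
    rw [hu, hα, hβ]; push_cast; field_simp; ring
  have e₂ : (c : ℝ) * (((l : ℝ) * a - k * b) * Real.pi / (a * b)) = c * β - c * α := by
    rw [hα, hβ]; field_simp
  have e₃ : (u : ℝ) * Real.pi / a = b * α + l * Real.pi := by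
    rw [hu, hα]; push_cast; field_simp
  have e₄ : (u : ℝ) * Real.pi / b = a * β + k * Real.pi := by
    rw [hu, hβ]; push_cast; field_simp; ring
  have e₅ : (c : ℝ) * α = -(b * α) + (k * b - k : ℤ) * Real.pi := by
    rw [hcR, hα]; push_cast; field_simp; ring
  have e₆ : (c : ℝ) * β = -(a * β) + (l * a - l : ℤ) * Real.pi := by
    rw [hcR, hβ]; push_cast; field_simp; ring
  have hsq : ∀ m : ℤ, ((-1 : ℝ) ^ m)⁻¹ = (-1) ^ m := fun m => by
    rw [← inv_zpow]; norm_num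
  rw [Chebyshev.T_real_cos, Chebyshev.T_real_cos, e₁, e₂, e₃, e₄, Real.cos_add, Real.cos_sub,
    e₅, e₆]
  simp only [Real.sin_add_int_mul_pi, Real.sin_neg]
  rw [hu, zpow_add₀ (by norm_num), zpow_sub₀ (by norm_num), zpow_sub₀ (by norm_num),
    div_eq_mul_inv, div_eq_mul_inv, hsq, hsq]
  ring

end HarmonicCurve

/-! ### Regularity, alternation and crossing signs -/

section HarmonicKnot

variable {a b : ℕ} {c : ℤ}

theorem exists_isCrossingPair_harmonicCurve_cos (ha : 0 < a) (hb : 0 < b) (hab : Nat.Coprime a b)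
    (hc : c = (a : ℤ) * b - a - b) {u : ℕ} (hau : ¬ a ∣ u) (hbu : ¬ b ∣ u) :
    ∃ s, IsCrossingPair (harmonicCurve a b c) (Real.cos (u * Real.pi / (a * b))) s ∧
      (Chebyshev.T ℝ c).eval (Real.cos (u * Real.pi / (a * b))) - (Chebyshev.T ℝ c).eval s =
      -2 * (-1) ^ u * Real.sin (u * Real.pi / a) * Real.sin (u * Real.pi / b) := by
  obtain ⟨p, q, hpq⟩ := Nat.isCoprime_iff_coprime.2 hab
  -- Any decomposition `u = kb + la` serves; this one is Bézout's identity times `u`.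
  have hu : (u : ℤ) = (u * q) * b + (u * p) * a := by linear_combination -(u : ℤ) * hpq
  have h₁ := isCrossingPair_harmonicCurve_cos (c := c) ha hb hu
    (by exact_mod_cast hau) (by exact_mod_cast hbu)
  have h₂ := eval_T_sub_eval_T_of_eq ha hb hc hu
  rw [Int.cast_natCast] at h₁ h₂
  rw [zpow_natCast] at h₂
  exact ⟨_, h₁, h₂⟩

/-- The parameter `t` fixes `u`, and two decompositions `u = kb + la` differ by a multiple of `(a,
-b)` in `(k, l)`, which moves the other angle by a multiple of `2π`. -/
theorem IsCrossingPair.eq_of_harmonicCurve (ha : 0 < a) (hb : 0 < b) (hab : Nat.Coprime a b)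
    {t s r : ℝ} (hs : IsCrossingPair (harmonicCurve a b c) t s)
    (hr : IsCrossingPair (harmonicCurve a b c) t r) : s = r := by
  have ha' : (a : ℝ) ≠ 0 := by positivity
  have hb' : (b : ℝ) ≠ 0 := by positivity
  obtain ⟨u, k, l, hu, htu, -, rfl, -, -⟩ :=
    exists_int_of_isCrossingPair_harmonicCurve ha hb hab hs
  obtain ⟨v, k', l', hv, htv, -, rfl, -, -⟩ :=
    exists_int_of_isCrossingPair_harmonicCurve ha hb hab hr
  have huv : u = v := by
    rw [htu] at htv
    field_simp at htv
    exact_mod_cast htv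
  have hkl : (k - k') * b = (l' - l) * a := by linear_combination huv - hu + hv
  obtain ⟨j, hj⟩ : (a : ℤ) ∣ k - k' :=
    (Nat.isCoprime_iff_coprime.2 hab).dvd_of_dvd_mul_right (Dvd.intro_left _ hkl.symm)
  have hj' : l' - l = j * b := by
    apply mul_right_cancel₀ (b := (a : ℤ)) (by omega)
    rw [← hkl, hj]
    ring
  have hjR : (k : ℝ) - k' = a * j := by exact_mod_cast hj
  have hjR' : (l' : ℝ) - l = j * b := by exact_mod_cast hj'
  rw [Real.cos_eq_cos_iff]
  refine ⟨j, Or.inl ?_⟩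
  field_simp
  linear_combination (a : ℝ) * hjR' + (b : ℝ) * hjR

theorem IsCrossingPair.exists_nat_of_harmonicCurve (ha : 0 < a) (hb : 0 < b)
    (hab : Nat.Coprime a b) (hc : c = (a : ℤ) * b - a - b) {t s : ℝ}
    (h : IsCrossingPair (harmonicCurve a b c) t s) :
    ∃ u : ℕ, u < a * b ∧ ¬ a ∣ u ∧ ¬ b ∣ u ∧ t = Real.cos (u * Real.pi / (a * b)) ∧
      (Chebyshev.T ℝ c).eval t - (Chebyshev.T ℝ c).eval s =
      -2 * (-1) ^ u * Real.sin (u * Real.pi / a) * Real.sin (u * Real.pi / b) := by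
  have hab0 : (0 : ℝ) < a * b := by positivity
  obtain ⟨u, k, l, -, htu, ht, -, hau, hbu⟩ :=
    exists_int_of_isCrossingPair_harmonicCurve ha hb hab h
  have h0 : 0 ≤ u := by
    have := Real.arccos_nonneg t
    rw [htu, le_div_iff₀ hab0, zero_mul] at this
    exact_mod_cast nonneg_of_mul_nonneg_left this Real.pi_pos
  have h1 : u ≤ a * b := by
    have := Real.arccos_le_pi t
    rw [htu, div_le_iff₀ hab0, mul_comm] at this
    exact_mod_cast le_of_mul_le_mul_left this Real.pi_pos
  have h2 : u ≠ a * b := fun h => hau (h ▸ dvd_mul_right _ _)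
  lift u to ℕ using h0
  rw [Int.cast_natCast] at ht
  norm_cast at hau hbu h1 h2
  obtain ⟨s', hs', hz⟩ := exists_isCrossingPair_harmonicCurve_cos ha hb hab hc hau hbu
  rw [← ht] at hs' hz
  rw [h.eq_of_harmonicCurve ha hb hab hs']
  exact ⟨u, lt_of_le_of_ne h1 h2, hau, hbu, ht, hz⟩

theorem neg_one_pow_mul_height_sub_pos (ha : 0 < a) (hb : 0 < b) {u : ℕ} (hau : ¬ a ∣ u)
    (hbu : ¬ b ∣ u) :
    0 < (-1) ^ (u + (u / a + u / b) + 1) *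
      (-2 * (-1) ^ u * Real.sin (u * Real.pi / a) * Real.sin (u * Real.pi / b)) := by
  have h := mul_pos (neg_one_pow_div_mul_sin_pos ha hau) (neg_one_pow_div_mul_sin_pos hb hbu)
  have hsq : ((-1 : ℝ) ^ u) * (-1) ^ u = 1 := by rw [← mul_pow]; norm_num
  have e : ((-1 : ℝ) ^ (u + (u / a + u / b) + 1) *
      (-2 * (-1) ^ u * Real.sin (u * Real.pi / a) * Real.sin (u * Real.pi / b))) =
      2 * ((-1) ^ (u / a) * Real.sin (u * Real.pi / a) *
        ((-1) ^ (u / b) * Real.sin (u * Real.pi / b))) := by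
    rw [pow_succ, pow_add, pow_add]
    linear_combination 2 * ((-1) ^ (u / a) * Real.sin (u * Real.pi / a) *
        ((-1) ^ (u / b) * Real.sin (u * Real.pi / b))) * hsq
  rw [e]
  linarith

theorem IsCrossingPair.height_ne_of_harmonicCurve (ha : 0 < a) (hb : 0 < b)
    (hab : Nat.Coprime a b) (hc : c = (a : ℤ) * b - a - b) {t s : ℝ}
    (h : IsCrossingPair (harmonicCurve a b c) t s) :
    (Chebyshev.T ℝ c).eval t ≠ (Chebyshev.T ℝ c).eval s := by
  obtain ⟨u, -, hau, hbu, -, hz⟩ := h.exists_nat_of_harmonicCurve ha hb hab hc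
  intro h'
  have := neg_one_pow_mul_height_sub_pos ha hb hau hbu
  rw [← hz, h', sub_self, mul_zero] at this
  exact lt_irrefl _ this

theorem exists_nat_of_mem_crossingParams_harmonicCurve (ha : 0 < a) (hb : 0 < b)
    (hab : Nat.Coprime a b) (hc : c = (a : ℤ) * b - a - b) {t : ℝ}
    (h : t ∈ crossingParams (harmonicCurve a b c)) :
    ∃ u : ℕ, u < a * b ∧ ¬ a ∣ u ∧ ¬ b ∣ u ∧ t = Real.cos (u * Real.pi / (a * b)) ∧
      (Odd (u + (u / a + u / b)) → IsOver (harmonicCurve a b c) t) ∧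
      (Even (u + (u / a + u / b)) → IsUnder (harmonicCurve a b c) t) := by
  obtain ⟨s, hs⟩ := h
  obtain ⟨u, hu, hau, hbu, ht, hz⟩ := hs.exists_nat_of_harmonicCurve ha hb hab hc
  have hpos := neg_one_pow_mul_height_sub_pos ha hb hau hbu
  rw [← hz, pow_succ] at hpos
  refine ⟨u, hu, hau, hbu, ht, fun h => ⟨s, hs, ?_⟩, fun h => ⟨s, hs, ?_⟩⟩
  · rw [h.neg_one_pow] at hpos
    simp only [harmonicCurve_two]
    linarith
  · rw [h.neg_one_pow] at hpos
    simp only [harmonicCurve_two]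
    linarith

theorem isRegularDiagram_harmonicCurve (ha : 0 < a) (hb : 0 < b) (hab : Nat.Coprime a b)
    (hc : c = (a : ℤ) * b - a - b) : IsRegularDiagram (harmonicCurve a b c) where
  smooth := contDiff_planeProjection_harmonicCurve a b c
  deriv_ne_zero t h := by
    have h₁ := deriv_planeProjection_harmonicCurve_zero a b c t
    have h₂ := deriv_planeProjection_harmonicCurve_one a b c t
    rw [h] at h₁ h₂
    exact Chebyshev.eval_derivative_T_ne_zero_of_coprime ha hb hab h₁.symm h₂.symm
  proper := tendsto_cocompact_of_tendsto_norm_apply 0 (Chebyshev.tendsto_norm_eval_T ha)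
  finite := by
    refine ((Set.finite_Iio (a * b)).image fun u : ℕ => Real.cos (u * Real.pi / (a * b))).subset ?_
    intro t ht
    obtain ⟨u, hu, -, -, rfl, -⟩ :=
      exists_nat_of_mem_crossingParams_harmonicCurve ha hb hab hc ht
    exact ⟨u, hu, rfl⟩
  no_triple _ _ _ hs hr := hs.eq_of_harmonicCurve ha hb hab hr
  transverse t s h := by
    have ha' : (a : ℝ) ≠ 0 := by positivity
    have hb' : (b : ℝ) ≠ 0 := by positivity
    obtain ⟨u, k, l, hu, -, rfl, rfl, hau, hbu⟩ :=
      exists_int_of_isCrossingPair_harmonicCurve ha hb hab h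
    set τ : ℝ := u * Real.pi / (a * b) with hτ
    set σ : ℝ := ((l : ℝ) * a - k * b) * Real.pi / (a * b) with hσ
    have hA : Real.sin (a * τ) ≠ 0 := by
      convert sin_int_mul_pi_div_ne_zero hb hbu using 2
      rw [hτ]; field_simp
    have hB : Real.sin (b * τ) ≠ 0 := by
      convert sin_int_mul_pi_div_ne_zero ha hau using 2
      rw [hτ]; field_simp
    -- The velocities at `τ` and `σ` are thus proportional to `(A, B)` and `(A, -B)` with `A, B ≠
    -- 0`, hence independent.
    have eA : Real.sin (a * σ) = Real.sin (a * τ) := by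
      rw [← Real.sin_sub_int_mul_two_pi (a * τ) k, hτ, hσ, hu]
      congr 1; push_cast; field_simp; ring
    have eB : Real.sin (b * σ) = -Real.sin (b * τ) := by
      rw [← Real.sin_neg, ← Real.sin_add_int_mul_two_pi (-(b * τ)) l, hτ, hσ, hu]
      congr 1; push_cast; field_simp; ring
    have x₁ := Chebyshev.eval_derivative_T_cos_mul_sin a τ
    have x₂ := Chebyshev.eval_derivative_T_cos_mul_sin a σ
    have y₁ := Chebyshev.eval_derivative_T_cos_mul_sin b τ
    have y₂ := Chebyshev.eval_derivative_T_cos_mul_sin b σ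
    push_cast at x₁ x₂ y₁ y₂
    rw [eA] at x₂
    rw [eB] at y₂
    have hsτ : Real.sin τ ≠ 0 := fun h => by
      rw [h, mul_zero] at x₁
      exact mul_ne_zero ha' hA x₁.symm
    have hsσ : Real.sin σ ≠ 0 := fun h => by
      rw [h, mul_zero] at x₂
      exact mul_ne_zero ha' hA x₂.symm
    rw [LinearIndependent.pair_iff]
    intro p q hpq
    have h₁ := congrArg (fun v => v 0) hpq
    have h₂ := congrArg (fun v => v 1) hpq
    simp only [PiLp.add_apply, PiLp.smul_apply, PiLp.zero_apply, smul_eq_mul,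
      deriv_planeProjection_harmonicCurve_zero, deriv_planeProjection_harmonicCurve_one] at h₁ h₂
    have e₁ : p * Real.sin σ + q * Real.sin τ = 0 := by
      apply (mul_eq_zero.1 (?_ : (a * Real.sin (a * τ)) * _ = 0)).resolve_left (mul_ne_zero ha' hA)
      linear_combination Real.sin τ * Real.sin σ * h₁ - p * Real.sin σ * x₁ - q * Real.sin τ * x₂
    have e₂ : p * Real.sin σ - q * Real.sin τ = 0 := by
      apply (mul_eq_zero.1 (?_ : (b * Real.sin (b * τ)) * _ = 0)).resolve_left (mul_ne_zero hb' hB)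
      linear_combination Real.sin τ * Real.sin σ * h₂ - p * Real.sin σ * y₁ - q * Real.sin τ * y₂
    exact ⟨(mul_eq_zero.1 (by linarith : p * Real.sin σ = 0)).resolve_right hsσ,
      (mul_eq_zero.1 (by linarith : q * Real.sin τ = 0)).resolve_right hsτ⟩
  height_ne _ _ h := h.height_ne_of_harmonicCurve ha hb hab hc

theorem isLongKnot_harmonicCurve (ha : 0 < a) (hb : 0 < b) (hab : Nat.Coprime a b)
    (hc : c = (a : ℤ) * b - a - b) : IsLongKnot (harmonicCurve a b c) where
  smooth := contDiff_harmonicCurve a b c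
  injective t s h := by
    by_contra hne
    have hp : IsCrossingPair (harmonicCurve a b c) t s :=
      ⟨hne, by simp only [planeProjection, h]⟩
    exact hp.height_ne_of_harmonicCurve ha hb hab hc (congrArg (fun v => v 2) h)
  deriv_ne_zero t h := by
    have h₁ := deriv_harmonicCurve_zero a b c t
    have h₂ := deriv_harmonicCurve_one a b c t
    rw [h] at h₁ h₂
    exact Chebyshev.eval_derivative_T_ne_zero_of_coprime ha hb hab h₁.symm h₂.symm
  proper := tendsto_cocompact_of_tendsto_norm_apply 0 (Chebyshev.tendsto_norm_eval_T ha)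

theorem OppositePassages.symm {γ : ℝ → EuclideanSpace ℝ (Fin 3)} {t t' : ℝ}
    (h : OppositePassages γ t t') : OppositePassages γ t' t :=
  h.elim (fun h => Or.inr ⟨h.2, h.1⟩) fun h => Or.inl ⟨h.2, h.1⟩

theorem cos_nat_mul_pi_div_lt_iff (ha : 0 < a) (hb : 0 < b) {u v : ℕ} (hu : u ≤ a * b)
    (hv : v ≤ a * b) :
    Real.cos (u * Real.pi / (a * b)) < Real.cos (v * Real.pi / (a * b)) ↔ v < u := by
  have hab0 : (0 : ℝ) < a * b := by positivity
  have hmem : ∀ w : ℕ, w ≤ a * b → (w : ℝ) * Real.pi / (a * b) ∈ Set.Icc 0 Real.pi := by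
    intro w hw
    have hw' : (w : ℝ) ≤ a * b := by exact_mod_cast hw
    refine ⟨by have := Real.pi_pos; positivity, ?_⟩
    rw [div_le_iff₀ hab0, mul_comm]
    exact mul_le_mul_of_nonneg_left hw' Real.pi_pos.le
  rw [Real.strictAntiOn_cos.lt_iff_gt (hmem u hu) (hmem v hv), div_lt_div_iff_of_pos_right hab0,
    mul_lt_mul_iff_left₀ Real.pi_pos, Nat.cast_lt]

theorem isAlternatingDiagram_harmonicCurve (ha : 0 < a) (hb : 0 < b) (hab : Nat.Coprime a b)
    (hc : c = (a : ℤ) * b - a - b) : IsAlternatingDiagram (harmonicCurve a b c) where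
  regular := isRegularDiagram_harmonicCurve ha hb hab hc
  consecutive t t' ht ht' hlt hbetween := by
    obtain ⟨u, hu, hau, hbu, rfl, hover, hunder⟩ :=
      exists_nat_of_mem_crossingParams_harmonicCurve ha hb hab hc ht
    obtain ⟨v, hv, hav, hbv, rfl, hover', hunder'⟩ :=
      exists_nat_of_mem_crossingParams_harmonicCurve ha hb hab hc ht'
    -- Cosine decreases on `[0, π]`, so the later parameter has the smaller index.
    have hvu : v < u := (cos_nat_mul_pi_div_lt_iff ha hb hu.le hv.le).1 hlt
    have hcount := div_add_div_of_consecutive hab hvu hu hau hbu fun r hr hr' => by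
      by_contra! hdvd
      have hr'' : r ≤ a * b := hr'.le.trans hu.le
      obtain ⟨s, hs, -⟩ := exists_isCrossingPair_harmonicCurve_cos ha hb hab hc hdvd.1 hdvd.2
      exact hbetween _ ((cos_nat_mul_pi_div_lt_iff ha hb hu.le hr'').2 hr')
        ((cos_nat_mul_pi_div_lt_iff ha hb hr'' hv.le).2 hr) ⟨s, hs⟩
    rcases Nat.even_or_odd (u + (u / a + u / b)) with h | h
    · refine Or.inr ⟨hunder h, hover' ?_⟩
      rw [Nat.even_iff] at h
      rw [Nat.odd_iff]
      omega
    · refine Or.inl ⟨hover h, hunder' ?_⟩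
      rw [Nat.odd_iff] at h
      rw [Nat.even_iff]
      omega
  closing t t' ht ht' := by
    -- Here `c = (a - 1)(b - 1) - 1`, and `a`, `b` are not both even.
    have hodd : Odd c := by
      have h : ¬ (Even a ∧ Even b) := fun h =>
        absurd (Nat.dvd_gcd h.1.two_dvd h.2.two_dvd) (by rw [hab]; norm_num)
      rw [hc]
      rcases Nat.even_or_odd a with h₁ | h₁ <;> rcases Nat.even_or_odd b with h₂ | h₂
      · exact absurd ⟨h₁, h₂⟩ h
      all_goals
        simp only [Int.odd_sub, Int.odd_mul, Int.odd_coe_nat, Int.even_coe_nat,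
          ← Nat.not_odd_iff_even] at *
        tauto
    have hneg : ∀ x, (Chebyshev.T ℝ c).eval (-x) = -(Chebyshev.T ℝ c).eval x := fun x => by
      rw [Chebyshev.T_eval_neg, Int.negOnePow_odd _ hodd]
      simp
    -- The set of crossing parameters is symmetric about 0.
    have htt : t = -t' := by
      obtain ⟨s, hs⟩ := ht.1
      obtain ⟨s', hs'⟩ := ht'.1
      have h₁ := ht.2 ⟨-s', hs'.neg_harmonicCurve⟩
      have h₂ := ht'.2 ⟨-s, hs.neg_harmonicCurve⟩
      linarith
    obtain ⟨s, hs⟩ := ht'.1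
    rw [htt]
    rcases lt_or_gt_of_ne (hs.height_ne_of_harmonicCurve ha hb hab hc) with h | h
    · refine Or.inl ⟨⟨-s, hs.neg_harmonicCurve, ?_⟩, ⟨s, hs, h⟩⟩
      rw [harmonicCurve_two, harmonicCurve_two, hneg, hneg]
      exact neg_lt_neg h
    · refine Or.inr ⟨⟨-s, hs.neg_harmonicCurve, ?_⟩, ⟨s, hs, h⟩⟩
      rw [harmonicCurve_two, harmonicCurve_two, hneg, hneg]
      exact neg_lt_neg h

/-- Since `x' = a sin aτ / sin τ` and `y' = b sin bτ / sin τ`, the sines of the height difference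
complete a positive square. -/
theorem sign_crossingD_harmonicCurve (ha : 0 < a) (hb : 0 < b) {u : ℕ} (hau : ¬ a ∣ u)
    (hbu : ¬ b ∣ u) {s : ℝ}
    (hz : (Chebyshev.T ℝ c).eval (Real.cos (u * Real.pi / (a * b))) - (Chebyshev.T ℝ c).eval s =
      -2 * (-1) ^ u * Real.sin (u * Real.pi / a) * Real.sin (u * Real.pi / b)) :
    SignType.sign (crossingD (harmonicCurve a b c) (Real.cos (u * Real.pi / (a * b))) s) =
      -(-1) ^ u := by
  have ha' : (a : ℝ) ≠ 0 := by positivity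
  have hb' : (b : ℝ) ≠ 0 := by positivity
  set τ : ℝ := u * Real.pi / (a * b) with hτ
  have e₁ : (u : ℝ) * Real.pi / a = b * τ := by rw [hτ]; field_simp
  have e₂ : (u : ℝ) * Real.pi / b = a * τ := by rw [hτ]; field_simp
  have hB : Real.sin (b * τ) ≠ 0 := by
    rw [← e₁]
    exact_mod_cast sin_int_mul_pi_div_ne_zero (u := u) ha (by exact_mod_cast hau)
  have hA : Real.sin (a * τ) ≠ 0 := by
    rw [← e₂]
    exact_mod_cast sin_int_mul_pi_div_ne_zero (u := u) hb (by exact_mod_cast hbu)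
  have x := Chebyshev.eval_derivative_T_cos_mul_sin a τ
  have y := Chebyshev.eval_derivative_T_cos_mul_sin b τ
  push_cast at x y
  have hsin : Real.sin τ ≠ 0 := fun h => by
    rw [h, mul_zero] at x
    exact mul_ne_zero ha' hA x.symm
  have hD : crossingD (harmonicCurve a b c) (Real.cos τ) s =
      -(-1) ^ u * (2 * a * b * (Real.sin (a * τ) * Real.sin (b * τ) / Real.sin τ) ^ 2) := by
    have d₁ : deriv (fun r => harmonicCurve a b c r 0) (Real.cos τ) =
        a * Real.sin (a * τ) / Real.sin τ := by
      rw [eq_div_iff hsin, ← x]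
      exact congrArg (· * Real.sin τ) (Chebyshev.T ℝ a).deriv
    have d₂ : deriv (fun r => harmonicCurve a b c r 1) (Real.cos τ) =
        b * Real.sin (b * τ) / Real.sin τ := by
      rw [eq_div_iff hsin, ← y]
      exact congrArg (· * Real.sin τ) (Chebyshev.T ℝ b).deriv
    rw [crossingD, d₁, d₂, harmonicCurve_two, harmonicCurve_two, hz, e₁, e₂]
    field_simp
  have hpos : 0 < 2 * (a : ℝ) * b * (Real.sin (a * τ) * Real.sin (b * τ) / Real.sin τ) ^ 2 := by
    positivity
  rw [hD, sign_mul, sign_pos hpos, mul_one, Left.sign_neg, sign_pow, Left.sign_neg, sign_one]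

end HarmonicKnot

theorem mainTheorem3 (a b : ℕ) (ha : 0 < a) (hb : 0 < b) (hab : Nat.Coprime a b)
    (c : ℤ) (hc : c = (a : ℤ) * (b : ℤ) - (a : ℤ) - (b : ℤ)) :
    IsLongKnot (harmonicCurve a b c) ∧
    IsAlternatingDiagram (harmonicCurve a b c) ∧
    ∀ u : ℕ, u ≤ a * b → ¬ a ∣ u → ¬ b ∣ u →
      ∃ s : ℝ, IsCrossingPair (harmonicCurve a b c)
          (Real.cos ((u : ℝ) * Real.pi / ((a : ℝ) * (b : ℝ)))) s ∧
        SignType.sign (crossingD (harmonicCurve a b c)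
          (Real.cos ((u : ℝ) * Real.pi / ((a : ℝ) * (b : ℝ)))) s) = -(-1) ^ u := by
  refine ⟨isLongKnot_harmonicCurve ha hb hab hc, isAlternatingDiagram_harmonicCurve ha hb hab hc,
    fun u _ hau hbu => ?_⟩
  obtain ⟨s, hs, hz⟩ := exists_isCrossingPair_harmonicCurve_cos ha hb hab hc hau hbu
  exact ⟨s, hs, sign_crossingD_harmonicCurve ha hb hau hbu hz⟩
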